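/- For $x\in\mathbb R$ let $\|x\|$ denote the distance from $x$ to the nearest integer. Let $\varphi$ be a real-valued function such that, for real $x\ge 1$, $x\varphi(x)$ is non-increasing and $0<x^2\varphi(x)\le 1$. Define \[ \Omega^{(\varphi)}:=\{\theta\in\mathbb R:\ \text{there exists } c>0 \text{ with } \|n\theta\|\ge n\varphi(cn)\text{ for all integers } n\ge 1\}. \] Let $\Psi^{(\varphi)}$ be the set of positive, non-increasing sequences $(\psi(n))_{n\ge1}$ for which there exist a strictly increasing sequence of positive integers $(t_i)_{i\ge1}$ and a non-decreasing function $\delta:\mathbb N\to[1,\infty)$ with $\delta(n)\to\infty$ as $n\to\infty$ such that \[ t_{i+1}\ge\frac{1}{t_i\varphi(t_i\delta(t_i))}\quad(i\ge1) \qquad\text{and}\qquad \sum_{i\ge1}t_i\,\psi\!\left(\left\lfloor\frac{1}{t_i\varphi(t_i\delta(t_i))}\right\rfloor\right)=\infty . \] Let $\Xi^{(\varphi)}$ be the set of $\theta\in\mathbb R$ such that, for every $\psi\in\Psi^{(\varphi)}$, for Lebesgue-almost every $s\in\mathbb R$ the inequality $\|n\theta-s\|<\psi(n)$ holds for infinitely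 many $n\in\mathbb N$. Then \[ \Omega^{(\varphi)}=\Xi^{(\varphi)} . \] (Here $\varphi$ may take arbitrary real values at arguments in $(0,1)$.) -/

import Mathlib

namespace Kurzweil

/-- `‖x‖`, the distance from the real number `x` to the nearest integer. -/
noncomputable def distInt (x : ℝ) : ℝ := |x - (round x : ℝ)|

/-- The standing assumptions on `φ`: `x φ(x)` is non-increasing and `0 < x² φ(x) ≤ 1`, for real
`x ≥ 1`. Nothing is assumed about the values of `φ` elsewhere. -/
structure IsAdmissible (φ : ℝ → ℝ) : Prop where
  antitone : AntitoneOn (fun x : ℝ => x * φ x) (Set.Ici 1)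
  pos : ∀ x : ℝ, 1 ≤ x → 0 < x ^ 2 * φ x
  le_one : ∀ x : ℝ, 1 ≤ x → x ^ 2 * φ x ≤ 1

/-- `Ω^(φ)`: the `θ` for which some `c > 0` satisfies `‖nθ‖ ≥ n φ(cn)` for all `n ≥ 1`. -/
def Omega (φ : ℝ → ℝ) : Set ℝ :=
  {θ | ∃ c : ℝ, 0 < c ∧ ∀ n : ℕ, 1 ≤ n → (n : ℝ) * φ (c * n) ≤ distInt (n * θ)}

/-- A positive, non-increasing sequence `ψ(1), ψ(2), …` (the value `ψ 0` plays no role). -/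
structure IsApproxSeq (ψ : ℕ → ℝ) : Prop where
  pos : ∀ n : ℕ, 1 ≤ n → 0 < ψ n
  antitone : AntitoneOn ψ (Set.Ici 1)

/-- The real number `1 / (t φ(t δ(t)))`. -/
noncomputable def scale (φ : ℝ → ℝ) (δ : ℕ → ℝ) (t : ℕ) : ℝ :=
  1 / ((t : ℝ) * φ ((t : ℝ) * δ t))

/-- Kurzweil's divergence condition on `ψ`: there are a strictly increasing sequence of positive
integers `t_i` and a non-decreasing function `δ ≥ 1` on the positive integers tending to infinity
with `t_{i+1} ≥ 1 / (t_i φ(t_i δ(t_i)))` and `∑ t_i ψ(⌊1 / (t_i φ(t_i δ(t_i)))⌋) = ∞`. -/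
def DivergenceCondition (φ : ℝ → ℝ) (ψ : ℕ → ℝ) : Prop :=
  ∃ (t : ℕ → ℕ) (δ : ℕ → ℝ),
    StrictMono t ∧ (∀ i, 1 ≤ t i) ∧
    MonotoneOn δ (Set.Ici 1) ∧ (∀ n : ℕ, 1 ≤ n → 1 ≤ δ n) ∧
    Filter.Tendsto δ Filter.atTop Filter.atTop ∧
    (∀ i, scale φ δ (t i) ≤ (t (i + 1) : ℝ)) ∧
    Filter.Tendsto (fun N : ℕ => ∑ i ∈ Finset.range N, (t i : ℝ) * ψ ⌊scale φ δ (t i)⌋₊)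
      Filter.atTop Filter.atTop

/-- `Ξ^(φ)`: the `θ` such that for every positive, non-increasing `ψ` satisfying the divergence
condition and almost every real `s`, `‖nθ - s‖ < ψ(n)` for infinitely many `n`. -/
def Xi (φ : ℝ → ℝ) : Set ℝ :=
  {θ | ∀ ψ : ℕ → ℝ, IsApproxSeq ψ → DivergenceCondition φ ψ →
    ∀ᵐ s : ℝ ∂MeasureTheory.volume, {n : ℕ | 1 ≤ n ∧ distInt (n * θ - s) < ψ n}.Infinite}

end Kurzweil

namespace Kurzweil

open MeasureTheory Metric Filter Topology

/-! Everything takes place on the circle, where the targets are the balls of radius `ψ n` about `n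
θ`.

`Omega ⊆ Xi`: θ is irrational, so ergodicity of the rotation makes the limsup set null or conull. If
it were null, some union of a tail of the balls would have measure below 1/8. Yet a lower bound on
`‖nθ‖` for `n ≤ 6t`, combined with Dirichlet's theorem, gives a denominator between `6t` and half of
`scale φ δ t`. Hence the multiples of θ with index up to `⌊scale φ δ t⌋` come close to every point
`j/t`. Any open set V inside the tail union with at most `t/4` boundary points misses half of the
cells around these points, so new balls add measure at least `t ψ(⌊scale φ δ t⌋)`
(`exists_enlargement_in_tailUnion`). Since `t i` grows geometrically, the boundary count stays under
control. The gains can therefore be summed, and divergence contradicts the bound 1/8.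

`Xi ⊆ Omega`: if θ is not in `Omega`, very good denominators `n i` exist, and long runs of multiples
of θ cluster around only `n i` points (`volume_near_multiples_le`). A step sequence ψ then has a
divergent sum although the sets it covers have summable measure, and Borel–Cantelli contradicts
membership in `Xi`. -/

/-! ### Balls on the circle -/

lemma distInt_eq_norm (x : ℝ) : distInt x = ‖(x : UnitAddCircle)‖ :=
  UnitAddCircle.norm_eq.symm

lemma norm_coe_le_abs_sub_int (x : ℝ) (z : ℤ) : ‖(x : UnitAddCircle)‖ ≤ |x - z| := by
  rw [UnitAddCircle.norm_eq]
  exact round_le x z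

lemma exists_coe_eq_abs_eq_norm (x : UnitAddCircle) :
    ∃ b : ℝ, (b : UnitAddCircle) = x ∧ |b| = ‖x‖ := by
  induction x using QuotientAddGroup.induction_on with
  | H a =>
    refine ⟨a - round a, ?_, UnitAddCircle.norm_eq.symm⟩
    have h : ((round a : ℝ) : UnitAddCircle) = 0 := by
      rw [AddCircle.coe_eq_zero_iff]
      exact ⟨round a, by simp⟩
    rw [AddCircle.coe_sub, h, sub_zero]

lemma ball_eq_image_coe (x : UnitAddCircle) (r : ℝ) :
    ball x r = (fun b : ℝ => x + (b : UnitAddCircle)) '' Set.Ioo (-r) r := by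
  ext y
  constructor
  · intro hy
    obtain ⟨b, hb, hb'⟩ := exists_coe_eq_abs_eq_norm (y - x)
    rw [mem_ball, dist_eq_norm, ← hb', abs_lt] at hy
    exact ⟨b, hy, by simp [hb]⟩
  · rintro ⟨b, hb, rfl⟩
    rw [mem_ball, dist_eq_norm, add_sub_cancel_left]
    exact (norm_coe_le_abs_sub_int b 0).trans_lt (by simpa using abs_lt.2 hb)

lemma isPreconnected_ball (x : UnitAddCircle) (r : ℝ) : IsPreconnected (ball x r) := by
  rw [ball_eq_image_coe]
  refine isPreconnected_Ioo.image _ (Continuous.continuousOn ?_)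
  exact continuous_const.add (AddCircle.continuous_mk' 1)

/-- Each added ball creates at most two boundary points; this keeps the number of partly covered
grid cells under control. -/
lemma frontier_ball_subset_pair (x : UnitAddCircle) (r : ℝ) :
    frontier (ball x r) ⊆ {x + (r : UnitAddCircle), x - (r : UnitAddCircle)} := by
  intro y hy
  have hy' : dist y x = r := frontier_ball_subset_sphere hy
  obtain ⟨b, hb, hb'⟩ := exists_coe_eq_abs_eq_norm (y - x)
  rw [dist_eq_norm, ← hb'] at hy'
  have hyb : y = x + (b : UnitAddCircle) := by rw [hb]; abel
  rcases abs_choice b with h | h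
  · left; rw [hyb, ← hy', h]
  · right
    rw [Set.mem_singleton_iff, hyb, ← hy', h, AddCircle.coe_neg, sub_neg_eq_add]

lemma volume_real_ball (x : UnitAddCircle) {r : ℝ} (h0 : 0 ≤ r) (h : 2 * r ≤ 1) :
    volume.real (ball x r) = 2 * r := by
  rw [measureReal_def, ← measure_congr (AddCircle.closedBall_ae_eq_ball (x := x) (ε := r)),
    AddCircle.volume_closedBall, min_eq_right h, ENNReal.toReal_ofReal (by linarith)]

/-- A property that holds almost everywhere on the circle pulls back to the line. -/
lemma ae_coe_of_ae {P : UnitAddCircle → Prop} (h : ∀ᵐ x : UnitAddCircle, P x) :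
    ∀ᵐ s : ℝ, P s := by
  have key : ∀ n : ℤ, ∀ᵐ s : ℝ ∂volume.restrict (Set.Ioc (n : ℝ) (n + 1)), P s := fun n =>
    (UnitAddCircle.measurePreserving_mk (n : ℝ)).quasiMeasurePreserving.ae h
  rw [← ae_restrict_iUnion_iff, iUnion_Ioc_intCast, Measure.restrict_univ] at key
  exact key

/-! ### Grid cells and the enlargement of an open set -/

/-- The cells of the grid of step `1 / t`. -/
def cell (t j : ℕ) : Set UnitAddCircle := ball (((j : ℝ) / t : ℝ) : UnitAddCircle) (1 / (2 * t))

lemma pairwiseDisjoint_cell {t : ℕ} (ht : 1 ≤ t) :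
    (Finset.range t : Set ℕ).PairwiseDisjoint (cell t) := by
  intro i hi j hj hij
  have ht0 : (0 : ℝ) < t := by exact_mod_cast ht
  refine ball_disjoint_ball ?_
  rw [dist_eq_norm, ← AddCircle.coe_sub, UnitAddCircle.norm_eq]
  set z := round ((i : ℝ) / t - j / t)
  have hne : (i : ℤ) - j - z * t ≠ 0 := by
    intro h
    have hi' : i < t := by simpa using hi
    have hj' : j < t := by simpa using hj
    have hdvd : (t : ℤ) ∣ i - j := ⟨z, by linarith⟩
    have := Int.eq_zero_of_abs_lt_dvd hdvd (by rw [abs_lt]; omega)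
    omega
  have h1 : (1 : ℝ) ≤ |(i : ℝ) - j - z * t| := by exact_mod_cast Int.one_le_abs hne
  have h2 : (i : ℝ) / t - j / t - z = (i - j - z * t) / t := by field_simp
  rw [h2, abs_div, abs_of_pos ht0, le_div_iff₀ ht0]
  calc _ = (1 : ℝ) := by field_simp; norm_num
    _ ≤ _ := h1

/-- An open set of measure at most `1/4` whose boundary has at most `t/4` points misses at least
half of the cells of the grid of step `1 / t`. -/
lemma exists_half_cells_disjoint {V : Set UnitAddCircle} (hV : IsOpen V)
    {F : Finset UnitAddCircle} (hF : frontier V ⊆ F) {t : ℕ} (ht : 1 ≤ t) (hFt : 4 * F.card ≤ t)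
    (hVm : volume.real V ≤ 1 / 4) :
    ∃ G ⊆ Finset.range t, t ≤ 2 * G.card ∧ ∀ j ∈ G, Disjoint (cell t j) V := by
  classical
  have ht0 : (0 : ℝ) < t := by exact_mod_cast ht
  set G := (Finset.range t).filter fun j => Disjoint (cell t j) V
  set I := (Finset.range t).filter fun j => cell t j ⊆ V
  set K := (Finset.range t).filter fun j => ∃ x ∈ F, x ∈ cell t j
  refine ⟨G, Finset.filter_subset _ _, ?_, fun j hj => (Finset.mem_filter.1 hj).2⟩
  -- A cell is connected, so it misses V, meets the boundary of V, or lies inside V. The last two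
  -- kinds number at most `t/4` each.
  have hcover : Finset.range t ⊆ G ∪ (I ∪ K) := by
    intro j hj
    by_cases hd : Disjoint (cell t j) V
    · exact Finset.mem_union_left _ (Finset.mem_filter.2 ⟨hj, hd⟩)
    by_cases hK : ∃ x ∈ F, x ∈ cell t j
    · simp only [Finset.mem_union]
      exact Or.inr (Or.inr (Finset.mem_filter.2 ⟨hj, hK⟩))
    simp only [Finset.mem_union]
    refine Or.inr (Or.inl (Finset.mem_filter.2 ⟨hj, ?_⟩))
    refine (isPreconnected_ball _ _).subset_left_of_subset_union hV
      (isClosed_closure (s := V)).isOpen_compl ?_ ?_ ?_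
    · exact Set.disjoint_compl_right_iff_subset.2 subset_closure
    · intro x hx
      by_contra hx'
      simp only [Set.mem_union, Set.mem_compl_iff, not_or, not_not] at hx'
      refine hK ⟨x, hF ?_, hx⟩
      rw [hV.frontier_eq]
      exact ⟨hx'.2, hx'.1⟩
    · exact Set.not_disjoint_iff_nonempty_inter.1 hd
  have hI : 4 * I.card ≤ t := by
    have h1 : volume.real (⋃ j ∈ I, cell t j) ≤ volume.real V :=
      measureReal_mono (Set.iUnion₂_subset fun j hj => (Finset.mem_filter.1 hj).2)
    rw [measureReal_biUnion_finset
      ((pairwiseDisjoint_cell ht).subset (by exact_mod_cast Finset.filter_subset _ _))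
      (fun j _ => measurableSet_ball)] at h1
    have h2 : ∀ j ∈ I, volume.real (cell t j) = 1 / t := by
      intro j _
      rw [cell, volume_real_ball _ (by positivity)]
      · field_simp
      · have : (1 : ℝ) ≤ t := by exact_mod_cast ht
        rw [mul_one_div, div_le_one (by positivity)]; linarith
    rw [Finset.sum_congr rfl h2, Finset.sum_const, nsmul_eq_mul, mul_one_div] at h1
    have h3 := h1.trans hVm
    rw [div_le_iff₀ ht0] at h3
    have : (4 * I.card : ℝ) ≤ t := by linarith
    exact_mod_cast this
  have hK : K.card ≤ F.card := by
    choose! f hfF hfc using fun (j : ℕ) (hj : j ∈ K) => (Finset.mem_filter.1 hj).2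
    refine Finset.card_le_card_of_injOn f hfF ?_
    intro i hi j hj hij
    by_contra hne
    have hd := pairwiseDisjoint_cell ht (Finset.mem_coe.2 (Finset.mem_filter.1 hi).1)
      (Finset.mem_coe.2 (Finset.mem_filter.1 hj).1) hne
    exact Set.disjoint_left.1 hd (hfc i hi) (hij ▸ hfc j hj)
  have hc := (Finset.card_le_card hcover).trans (Finset.card_union_le _ _)
  have hc' := Finset.card_union_le I K
  rw [Finset.card_range] at hc
  omega

/-- Adding to `V` balls around points close to the grid points increases the measure by at least
half of the total measure of the balls. -/
lemma exists_enlargement {V : Set UnitAddCircle} (hV : IsOpen V)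
    {F : Finset UnitAddCircle} (hF : frontier V ⊆ F) {t : ℕ} (ht : 1 ≤ t) (hFt : 4 * F.card ≤ t)
    (hVm : volume.real V ≤ 1 / 4) (p : ℕ → UnitAddCircle)
    (hp : ∀ j < t, dist (p j) (((j : ℝ) / t : ℝ) : UnitAddCircle) ≤ 1 / (4 * t))
    {ρ : ℝ} (hρ : 0 < ρ) (hρt : ρ ≤ 1 / (4 * t)) {U : Set UnitAddCircle} (hVU : V ⊆ U)
    (hpU : ∀ j < t, ball (p j) ρ ⊆ U) :
    ∃ (W : Set UnitAddCircle) (F' : Finset UnitAddCircle), IsOpen W ∧ W ⊆ U ∧ frontier W ⊆ F' ∧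
      F'.card ≤ F.card + 2 * t ∧ volume.real V + t * ρ ≤ volume.real W := by
  classical
  have ht0 : (0 : ℝ) < t := by exact_mod_cast ht
  obtain ⟨G, hGt, hGc, hGd⟩ := exists_half_cells_disjoint hV hF ht hFt hVm
  have hsub : ∀ j ∈ G, ball (p j) ρ ⊆ cell t j := by
    intro j hj
    refine ball_subset_ball' ?_
    have := hp j (Finset.mem_range.1 (hGt hj))
    -- Displacement of the centre plus the radius `ρ` is at most the cell radius, so the new balls
    -- stay in their own cells.
    have h2 : (1 : ℝ) / (4 * t) + 1 / (4 * t) = 1 / (2 * t) := by field_simp; norm_num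
    linarith
  have hfr : ∀ H : Finset ℕ, frontier (V ∪ ⋃ j ∈ H, ball (p j) ρ) ⊆
      (F ∪ H.biUnion fun j => {p j + (ρ : UnitAddCircle), p j - (ρ : UnitAddCircle)} :
        Finset UnitAddCircle) := by
    intro H
    induction H using Finset.induction_on with
    | empty => simpa using hF
    | insert a H _ ih =>
      have e : (V ∪ ⋃ j ∈ insert a H, ball (p j) ρ) =
          (V ∪ ⋃ j ∈ H, ball (p j) ρ) ∪ ball (p a) ρ := by
        rw [Finset.set_biUnion_insert, Set.union_comm (ball _ _), Set.union_assoc]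
      rw [e]
      intro x hx
      rcases frontier_union_subset _ _ hx with h | h
      · have := ih h.1
        simp only [Finset.coe_union, Set.mem_union, Finset.mem_coe, Finset.mem_biUnion,
          Finset.mem_insert] at this ⊢
        grind
      · have := frontier_ball_subset_pair _ _ h.2
        simp only [Finset.coe_union, Set.mem_union, Finset.mem_coe, Finset.mem_biUnion,
          Finset.mem_insert, Finset.mem_singleton, Set.mem_insert_iff,
          Set.mem_singleton_iff] at this ⊢
        grind
  refine ⟨V ∪ ⋃ j ∈ G, ball (p j) ρ, _, hV.union (isOpen_biUnion fun _ _ => isOpen_ball),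
    Set.union_subset hVU (Set.iUnion₂_subset fun j hj => hpU j (Finset.mem_range.1 (hGt hj))),
    hfr G, ?_, ?_⟩
  · refine (Finset.card_union_le _ _).trans (Nat.add_le_add_left ?_ _)
    refine (Finset.card_biUnion_le_card_mul _ _ 2 fun j _ => Finset.card_le_two).trans ?_
    have := Finset.card_le_card hGt
    rw [Finset.card_range] at this
    omega
  · have hd : Disjoint V (⋃ j ∈ G, ball (p j) ρ) :=
      Set.disjoint_iUnion₂_right.2 fun j hj => ((hGd j hj).mono_left (hsub j hj)).symm
    rw [measureReal_union hd (Finset.measurableSet_biUnion _ fun _ _ => measurableSet_ball)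
        (h₂ := measure_ne_top _ _),
      measureReal_biUnion_finset _ fun _ _ => measurableSet_ball]
    · have h1 : ∀ j ∈ G, volume.real (ball (p j) ρ) = 2 * ρ := by
        intro j _
        refine volume_real_ball _ hρ.le ?_
        have : (1 : ℝ) ≤ t := by exact_mod_cast ht
        have : (1 : ℝ) / (4 * t) ≤ 1 / 4 := by
          apply one_div_le_one_div_of_le <;> linarith
        linarith
      rw [Finset.sum_congr rfl h1, Finset.sum_const, nsmul_eq_mul]
      have : (t : ℝ) ≤ 2 * G.card := by exact_mod_cast hGc
      nlinarith
    · intro i hi j hj hij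
      exact ((pairwiseDisjoint_cell ht) (Finset.mem_coe.2 (hGt hi)) (Finset.mem_coe.2 (hGt hj))
        hij).mono (hsub i hi) (hsub j hj)

/-! ### Rational approximation to θ and the bound defining `Omega` -/

/-- If `r` approximates `θ` to within `1 / den²`, then any `den` consecutive multiples of `θ` are
`3 / (2 den)`-dense modulo one. -/
lemma exists_multiple_near {θ : ℝ} {r : ℚ} (h : |θ - r| ≤ 1 / (r.den : ℝ) ^ 2) (m : ℕ) (y : ℝ) :
    ∃ n : ℕ, m ≤ n ∧ n < m + r.den ∧
      ‖((n * θ - y : ℝ) : UnitAddCircle)‖ ≤ 3 / (2 * r.den) := by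
  set d := r.den with hd
  have hd0 : 0 < d := r.pos
  have hdR : (0 : ℝ) < d := by exact_mod_cast hd0
  obtain ⟨u, v, huv⟩ : IsCoprime r.num (d : ℤ) := by
    rw [Int.isCoprime_iff_gcd_eq_one]
    exact r.reduced
  -- `a/d` is the multiple of `1/d` nearest to `y - mθ`. By Bézout, `k ≡ a u` mod `d` gives `k r ≡
  -- a/d` mod 1. The error is `1/d` from `k(θ - r)` plus `1/(2d)` from rounding.
  set a := round ((d : ℝ) * (y - m * θ)) with ha
  have hk0 : 0 ≤ (a * u) % (d : ℤ) := Int.emod_nonneg _ (by omega)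
  obtain ⟨k, hk⟩ := Int.eq_ofNat_of_zero_le hk0
  have hkd : k < d := by
    have := Int.emod_lt_of_pos (a * u) (by exact_mod_cast hd0 : (0 : ℤ) < d)
    omega
  have hdiv := Int.emod_add_mul_ediv (a * u) d
  rw [hk] at hdiv
  set w := (a * u) / (d : ℤ)
  have hkr : (k : ℝ) * r.num = a - d * (a * v + w * r.num : ℤ) := by
    have : (k : ℤ) * r.num = a - d * (a * v + w * r.num) := by
      linear_combination r.num * hdiv + a * huv
    exact_mod_cast this
  have hr : (r : ℝ) = r.num / d := by rw [hd]; exact_mod_cast (Rat.num_div_den r).symm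
  refine ⟨m + k, by omega, by omega, ?_⟩
  refine (norm_coe_le_abs_sub_int _ (-(a * v + w * r.num))).trans ?_
  have e : ((m + k : ℕ) : ℝ) * θ - y - ((-(a * v + w * r.num) : ℤ) : ℝ) =
      k * (θ - r) + (a - d * (y - m * θ)) / d := by
    have : (k : ℝ) * r = a / d - (a * v + w * r.num : ℤ) := by
      rw [hr]; field_simp; linarith
    rw [mul_sub, this]
    push_cast
    field_simp
    ring
  rw [e]
  have h1 : |(k : ℝ) * (θ - r)| ≤ 1 / d := by
    rw [abs_mul, abs_of_nonneg (Nat.cast_nonneg k)]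
    calc (k : ℝ) * |θ - r| ≤ d * (1 / (d : ℝ) ^ 2) := by gcongr
      _ = 1 / d := by field_simp
  have h2 : |((a : ℝ) - d * (y - m * θ)) / d| ≤ 1 / (2 * d) := by
    rw [abs_div, abs_of_pos hdR, abs_sub_comm, div_le_iff₀ hdR]
    refine (abs_sub_round _).trans (le_of_eq ?_)
    field_simp
  refine (abs_add_le _ _).trans ((add_le_add h1 h2).trans (le_of_eq ?_))
  field_simp
  norm_num

namespace IsAdmissible

variable {φ : ℝ → ℝ} (hφ : IsAdmissible φ)

include hφ

lemma phi_pos {x : ℝ} (hx : 1 ≤ x) : 0 < φ x :=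
  pos_of_mul_pos_right (hφ.pos x hx) (sq_nonneg x)

/-- Passing to a larger constant weakens the bound in the definition of `Omega`. -/
lemma mul_phi_anti {c c' x : ℝ} (hc : 0 < c) (hcc : c ≤ c') (hx : 0 < x) (hcx : 1 ≤ c * x) :
    x * φ (c' * x) ≤ x * φ (c * x) := by
  have hcx' : c * x ≤ c' * x := by gcongr
  have h := hφ.antitone (Set.mem_Ici.2 hcx) (Set.mem_Ici.2 (hcx.trans hcx')) hcx'
  have h0 := (hφ.phi_pos (hcx.trans hcx')).le
  simp only at h
  refine le_of_mul_le_mul_left ?_ hc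
  calc c * (x * φ (c' * x)) ≤ c' * (x * φ (c' * x)) := by gcongr
    _ = c' * x * φ (c' * x) := by ring
    _ ≤ c * x * φ (c * x) := h
    _ = _ := by ring

lemma le_scale {δ : ℕ → ℝ} {t : ℕ} (ht : 1 ≤ t) (hδ : 1 ≤ δ t) : t * δ t ≤ scale φ δ t := by
  have ht1 : (1 : ℝ) ≤ t := by exact_mod_cast ht
  have hx : 1 ≤ t * δ t := one_le_mul_of_one_le_of_one_le ht1 hδ
  have h := hφ.le_one _ hx
  have h0 := hφ.phi_pos hx
  rw [scale, le_div_iff₀ (by positivity)]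
  refine le_trans ?_ h
  rw [pow_two]
  have : t * φ (t * δ t) ≤ (t * δ t) * φ (t * δ t) := by
    gcongr
    nlinarith
  nlinarith

/-- If `θ` lies in `Omega φ`, it has a good rational approximation whose denominator lies
between `6 t` and half of `1 / (t φ(t d))`. -/
lemma exists_rat_approx {θ c : ℝ} (hc : 1 ≤ c)
    (hθ : ∀ n : ℕ, 1 ≤ n → (n : ℝ) * φ (c * n) ≤ distInt (n * θ)) {t : ℕ} (ht : 1 ≤ t) {d : ℝ}
    (hd : 6 * c ≤ d) :
    ∃ r : ℚ, |θ - r| ≤ 1 / (r.den : ℝ) ^ 2 ∧ 6 * t ≤ r.den ∧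
      2 * (r.den : ℝ) ≤ 1 / (t * φ (t * d)) := by
  have ht1 : (1 : ℝ) ≤ t := by exact_mod_cast ht
  have hx : 1 ≤ 6 * t * c := by nlinarith
  -- Monotonicity of `x φ(x)` makes η a lower bound for `‖nθ‖` over all `n ≤ 6t`. Dirichlet with
  -- bound `⌊1/η⌋` gives `‖qθ‖ < η`, which forces `q > 6t`. The factor 6 is what turns `3/(2q)` into
  -- at most `1/(4t)`.
  set η := 6 * t * φ (6 * t * c) with hη
  have hφ0 := hφ.phi_pos hx
  have hη0 : 0 < η := by positivity
  have hη1 : η ≤ 1 := by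
    refine le_trans ?_ (hφ.le_one _ hx)
    rw [hη]
    gcongr
    nlinarith
  have hmin : ∀ n : ℕ, 1 ≤ n → n ≤ 6 * t → η ≤ distInt (n * θ) := by
    intro n hn hnt
    refine le_trans ?_ (hθ n hn)
    have hn1 : (1 : ℝ) ≤ n := by exact_mod_cast hn
    have hnt' : (n : ℝ) ≤ 6 * t := by exact_mod_cast hnt
    have hcn : 1 ≤ c * n := one_le_mul_of_one_le_of_one_le hc hn1
    have hle : c * n ≤ 6 * t * c := by nlinarith
    have h := hφ.antitone (Set.mem_Ici.2 hcn) (Set.mem_Ici.2 hx) hle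
    simp only at h
    refine le_of_mul_le_mul_left ?_ (by linarith : 0 < c)
    rw [hη]
    linarith
  have hN : 0 < ⌊1 / η⌋₊ := Nat.floor_pos.2 (by rwa [le_div_iff₀ hη0, one_mul])
  obtain ⟨r, hr, hrN⟩ := Real.exists_rat_abs_sub_le_and_den_le θ hN
  have hden : (0 : ℝ) < r.den := by exact_mod_cast r.pos
  have hrη : (r.den : ℝ) ≤ 1 / η :=
    le_trans (by exact_mod_cast hrN) (Nat.floor_le (by positivity))
  refine ⟨r, hr.trans ?_, ?_, ?_⟩
  · have : (r.den : ℝ) ≤ ⌊1 / η⌋₊ := by exact_mod_cast hrN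
    apply one_div_le_one_div_of_le (by positivity)
    nlinarith
  · by_contra! hlt
    have h1 := hmin r.den r.pos hlt.le
    have h2 : distInt (r.den * θ) ≤ 1 / (⌊1 / η⌋₊ + 1) := by
      rw [distInt_eq_norm]
      refine (norm_coe_le_abs_sub_int _ r.num).trans ?_
      have e : (r.den : ℝ) * θ - r.num = r.den * (θ - r) := by
        have : (r : ℝ) * r.den = r.num := by exact_mod_cast Rat.mul_den_eq_num r
        linarith
      rw [e, abs_mul, abs_of_pos hden]
      calc (r.den : ℝ) * |θ - r| ≤ (r.den : ℝ) * (1 / ((⌊1 / η⌋₊ + 1) * r.den)) := by gcongr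
        _ = _ := by field_simp
    have h3 : 1 / ((⌊1 / η⌋₊ : ℝ) + 1) < η := by
      rw [div_lt_comm₀ (by positivity) hη0]
      exact Nat.lt_floor_add_one _
    linarith
  · have hle : 6 * t * c ≤ t * d := by nlinarith
    have h := hφ.antitone (Set.mem_Ici.2 hx) (Set.mem_Ici.2 (hx.trans hle)) hle
    simp only at h
    have h0 := hφ.phi_pos (hx.trans hle)
    have h1 : d * (t * φ (t * d)) ≤ c * η := by rw [hη]; linarith
    have h2 : 2 * (t * φ (t * d)) ≤ η := by
      have h3 : 6 * c * (t * φ (t * d)) ≤ c * η := le_trans (by gcongr) h1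
      have h4 : 6 * (t * φ (t * d)) ≤ η := by
        refine le_of_mul_le_mul_left ?_ (by linarith : 0 < c)
        linarith
      have : 0 < t * φ (t * d) := by positivity
      linarith
    calc 2 * (r.den : ℝ) ≤ 2 * (1 / η) := by gcongr
      _ ≤ 2 * (1 / (2 * (t * φ (t * d)))) := by
        gcongr
      _ = _ := by field_simp

end IsAdmissible

lemma distInt_nonneg (x : ℝ) : 0 ≤ distInt x := abs_nonneg _

lemma distInt_natCast_mul_le (k : ℕ) (x : ℝ) : distInt (k * x) ≤ k * distInt x := by
  rw [distInt_eq_norm, distInt_eq_norm]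
  have : ((k * x : ℝ) : UnitAddCircle) = k • (x : UnitAddCircle) := by
    rw [← AddCircle.coe_nsmul, nsmul_eq_mul]
  rw [this]
  exact norm_nsmul_le

lemma exists_pos_le_distInt {θ : ℝ} (h : ∀ n : ℕ, 1 ≤ n → 0 < distInt (n * θ)) (N : ℕ) :
    ∃ ε > 0, ∀ n : ℕ, 1 ≤ n → n < N → ε ≤ distInt (n * θ) := by
  induction N with
  | zero => exact ⟨1, one_pos, by omega⟩
  | succ N ih =>
    obtain ⟨ε, hε, hN⟩ := ih
    rcases Nat.eq_zero_or_pos N with rfl | hpos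
    · exact ⟨1, one_pos, by omega⟩
    · refine ⟨min ε (distInt (N * θ)), lt_min hε (h N hpos), fun n hn hnN => ?_⟩
      rcases Nat.lt_succ_iff_lt_or_eq.1 hnN with hlt | rfl
      · exact (min_le_left _ _).trans (hN n hn hlt)
      · exact min_le_right _ _

lemma IsAdmissible.mul_phi_le {φ : ℝ → ℝ} (hφ : IsAdmissible φ) {c : ℝ} (hc : 1 ≤ c) {n : ℕ}
    (hn : 1 ≤ n) : n * φ (c * n) ≤ 1 / c := by
  have hn1 : (1 : ℝ) ≤ n := by exact_mod_cast hn
  have hx : 1 ≤ c * n := one_le_mul_of_one_le_of_one_le hc hn1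
  have h := hφ.le_one _ hx
  have h0 := hφ.phi_pos hx
  rw [le_div_iff₀ (by linarith)]
  refine le_trans ?_ h
  calc n * φ (c * n) * c = (c * n) * φ (c * n) := by ring
    _ ≤ (c * n) ^ 2 * φ (c * n) := by gcongr; nlinarith

/-- The bound says nothing useful while `c n < 1`, where φ is arbitrary; a multiple `k n` with `c k
n ≥ 1` has positive distance, and `‖k n θ‖ ≤ k ‖nθ‖`. -/
lemma distInt_pos_of_mem_Omega {φ : ℝ → ℝ} (hφ : IsAdmissible φ) {θ : ℝ} (hθ : θ ∈ Omega φ) {n : ℕ}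
    (hn : 1 ≤ n) : 0 < distInt (n * θ) := by
  obtain ⟨c, hc, h⟩ := hθ
  obtain ⟨k, hk⟩ := exists_nat_ge (1 / c)
  have hn1 : (1 : ℝ) ≤ n := by exact_mod_cast hn
  have hk0 : (0 : ℝ) < k := lt_of_lt_of_le (by positivity) hk
  have hk1 : 1 ≤ k := by exact_mod_cast hk0
  have hx : 1 ≤ c * (k * n : ℕ) := by
    rw [div_le_iff₀ hc] at hk
    push_cast
    nlinarith
  have h1 := h (k * n) (Nat.mul_pos hk1 hn)
  have h2 := hφ.phi_pos hx
  have h3 : 0 < distInt ((k * n : ℕ) * θ) := lt_of_lt_of_le (by positivity) h1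
  have h4 := distInt_natCast_mul_le k (n * θ)
  rw [← mul_assoc, ← Nat.cast_mul] at h4
  exact pos_of_mul_pos_right (h3.trans_le h4) hk0.le

/-- For `c ≥ 1` the bound is at most `1/c`, so enlarging `c` also covers the finitely many `n <
1/c`, where `‖nθ‖` has a positive minimum. -/
lemma exists_one_le_const_of_mem_Omega {φ : ℝ → ℝ} (hφ : IsAdmissible φ) {θ : ℝ}
    (hθ : θ ∈ Omega φ) :
    ∃ c : ℝ, 1 ≤ c ∧ ∀ n : ℕ, 1 ≤ n → (n : ℝ) * φ (c * n) ≤ distInt (n * θ) := by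
  have hpos := fun (n : ℕ) (hn : 1 ≤ n) => distInt_pos_of_mem_Omega hφ hθ hn
  obtain ⟨c, hc, h⟩ := hθ
  obtain ⟨N, hN⟩ := exists_nat_ge (1 / c)
  obtain ⟨ε, hε, hεN⟩ := exists_pos_le_distInt hpos N
  refine ⟨max (max c 1) (1 / ε), (le_max_right c 1).trans (le_max_left _ _), fun n hn => ?_⟩
  have hn1 : (1 : ℝ) ≤ n := by exact_mod_cast hn
  by_cases hnN : n < N
  · refine le_trans (hφ.mul_phi_le ((le_max_right c 1).trans (le_max_left _ _)) hn) ?_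
    refine le_trans ?_ (hεN n hn hnN)
    rw [div_le_comm₀ (by positivity) hε]
    exact le_max_right _ _
  · refine (hφ.mul_phi_anti hc ((le_max_left c 1).trans (le_max_left _ _)) (by linarith) ?_).trans
      (h n hn)
    have : (N : ℝ) ≤ n := by exact_mod_cast not_lt.1 hnN
    have := hN.trans this
    rwa [div_le_iff₀ hc, mul_comm] at this

/-! ### The zero-one law and the inclusion `Omega ⊆ Xi` -/

/-- The union of the target balls with indices at least `m`. -/
def tailUnion (θ : ℝ) (ψ : ℕ → ℝ) (m : ℕ) : Set UnitAddCircle :=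
  ⋃ n : ℕ, ⋃ _ : m ≤ n, ball ((n * θ : ℝ) : UnitAddCircle) (ψ n)

lemma isOpen_tailUnion (θ : ℝ) (ψ : ℕ → ℝ) (m : ℕ) : IsOpen (tailUnion θ ψ m) :=
  isOpen_iUnion fun _ => isOpen_iUnion fun _ => isOpen_ball

lemma antitone_tailUnion (θ : ℝ) (ψ : ℕ → ℝ) : Antitone (tailUnion θ ψ) := fun _ _ hab =>
  Set.iUnion_mono fun _ => Set.iUnion_mono' fun h => ⟨hab.trans h, subset_rfl⟩

lemma mem_tailUnion {θ : ℝ} {ψ : ℕ → ℝ} {m : ℕ} {x : UnitAddCircle} :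
    x ∈ tailUnion θ ψ m ↔ ∃ n, m ≤ n ∧ ‖((n * θ : ℝ) : UnitAddCircle) - x‖ < ψ n := by
  simp only [tailUnion, Set.mem_iUnion, mem_ball', dist_eq_norm, exists_prop]

/-- The limsup set of the target balls is null or conull. -/
lemma iInter_tailUnion_ae_empty_or_univ {θ : ℝ} (hθ : ∀ n : ℕ, 1 ≤ n → 0 < distInt (n * θ))
    {ψ : ℕ → ℝ} (hψ : IsApproxSeq ψ) :
    (⋂ m, tailUnion θ ψ m) =ᵐ[volume] (∅ : Set UnitAddCircle) ∨
      (⋂ m, tailUnion θ ψ m) =ᵐ[volume] Set.univ := by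
  have horder : addOrderOf (θ : UnitAddCircle) = 0 := by
    rw [addOrderOf_eq_zero_iff']
    intro n hn h0
    have := hθ n hn
    rw [distInt_eq_norm, ← nsmul_eq_mul, AddCircle.coe_nsmul, h0, norm_zero] at this
    exact lt_irrefl _ this
  refine (AddCircle.ergodic_add_right.2 horder).ae_empty_or_univ_of_preimage_ae_le
    (MeasurableSet.iInter fun m => (isOpen_tailUnion θ ψ m).measurableSet).nullMeasurableSet
    (LE.le.eventuallyLE ?_)
  intro x hx
  refine Set.mem_iInter.2 fun m => ?_
  -- If `x + θ` is near `(k+1)θ`, then `x` is near `kθ`, with a radius at least as large. The shift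
  -- by 2 ensures `k ≥ 1`, where ψ is monotone.
  obtain ⟨n, hmn, hn⟩ := mem_tailUnion.1 (Set.mem_iInter.1 hx (m + 2))
  obtain ⟨k, rfl⟩ : ∃ k, n = k + 1 := ⟨n - 1, by omega⟩
  refine mem_tailUnion.2 ⟨k, by omega, ?_⟩
  have h1 : ψ (k + 1) ≤ ψ k :=
    hψ.antitone (Set.mem_Ici.2 (by omega)) (Set.mem_Ici.2 (by omega)) (by omega)
  refine lt_of_eq_of_lt ?_ (hn.trans_le h1)
  congr 1
  push_cast
  rw [add_mul, one_mul, AddCircle.coe_add]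
  abel

/-- One step of the construction: the balls with indices up to `⌊scale φ δ t⌋` contribute a new
part of measure at least `t * ψ ⌊scale φ δ t⌋`. -/
lemma exists_enlargement_in_tailUnion {φ : ℝ → ℝ} (hφ : IsAdmissible φ) {θ c : ℝ} (hc : 1 ≤ c)
    (hθ : ∀ n : ℕ, 1 ≤ n → (n : ℝ) * φ (c * n) ≤ distInt (n * θ))
    {ψ : ℕ → ℝ} (hψ : IsApproxSeq ψ) {m : ℕ} (hm : 1 ≤ m)
    (hU : volume.real (tailUnion θ ψ m) < 1 / 8) {δ : ℕ → ℝ} {t : ℕ} (hmt : 2 * m ≤ t)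
    (hδ : 6 * c ≤ δ t) {V : Set UnitAddCircle} (hV : IsOpen V) (hVU : V ⊆ tailUnion θ ψ m)
    {F : Finset UnitAddCircle} (hF : frontier V ⊆ F) (hFt : 4 * F.card ≤ t) :
    ∃ (W : Set UnitAddCircle) (F' : Finset UnitAddCircle), IsOpen W ∧ W ⊆ tailUnion θ ψ m ∧
      frontier W ⊆ F' ∧ F'.card ≤ F.card + 2 * t ∧
      volume.real V + t * ψ ⌊scale φ δ t⌋₊ ≤ volume.real W := by
  have ht : 1 ≤ t := by omega
  have ht0 : (0 : ℝ) < t := by exact_mod_cast ht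
  have hS := hφ.le_scale (φ := φ) ht (by linarith : 1 ≤ δ t)
  obtain ⟨r, hr, hr6, hrS⟩ := hφ.exists_rat_approx hc hθ ht hδ
  change 2 * (r.den : ℝ) ≤ scale φ δ t at hrS
  set S := scale φ δ t
  have hden : (0 : ℝ) < r.den := by exact_mod_cast r.pos
  have hr6' : (6 * t : ℝ) ≤ r.den := by exact_mod_cast hr6
  have hfloor : m + r.den ≤ ⌊S⌋₊ := by
    refine Nat.le_floor ?_
    push_cast
    have : (2 * m : ℝ) ≤ t := by exact_mod_cast hmt
    nlinarith
  have hψS := hψ.pos ⌊S⌋₊ (by omega)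
  choose p hpm hpd hpn using fun j : ℕ => exists_multiple_near hr m ((j : ℝ) / t)
  have hVm : volume.real V ≤ volume.real (tailUnion θ ψ m) := measureReal_mono hVU
  obtain ⟨W, F', hW, hWU, hF', hcard, hmeas⟩ := exists_enlargement hV hF ht hFt (by linarith)
    (fun j => ((p j * θ : ℝ) : UnitAddCircle)) (ρ := min (ψ ⌊S⌋₊) (1 / (4 * t)))
    (U := tailUnion θ ψ m)
    (by
      intro j _
      rw [dist_eq_norm, ← AddCircle.coe_sub]
      refine (hpn j).trans ?_
      rw [div_le_div_iff₀ (by positivity) (by positivity)]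
      linarith)
    (lt_min hψS (by positivity)) (min_le_right _ _) hVU
    (by
      intro j _ x hx
      rw [mem_ball', dist_eq_norm] at hx
      refine mem_tailUnion.2 ⟨p j, hpm j, hx.trans_le ((min_le_left _ _).trans ?_)⟩
      have := hpm j
      have := hpd j
      exact hψ.antitone (Set.mem_Ici.2 (by omega)) (Set.mem_Ici.2 (by omega)) (by omega))
  refine ⟨W, F', hW, hWU, hF', hcard, ?_⟩
  -- If the radius were `1/(4t)`, the gain would be 1/4, more than the whole tail union has.
  rcases min_choice (ψ ⌊S⌋₊) (1 / (4 * (t : ℝ))) with h | h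
  · rwa [h] at hmeas
  · exfalso
    rw [h] at hmeas
    have h1 : volume.real W ≤ volume.real (tailUnion θ ψ m) := measureReal_mono hWU
    have h2 : (t : ℝ) * (1 / (4 * t)) = 1 / 4 := by field_simp
    have h3 : 0 ≤ volume.real V := measureReal_nonneg
    linarith

theorem Omega_subset_Xi {φ : ℝ → ℝ} (hφ : IsAdmissible φ) : Omega φ ⊆ Xi φ := by
  intro θ hθ ψ hψ ⟨t, δ, htmono, ht1, _, hδ1, hδtop, hscale, hdiv⟩
  have hpos := fun (n : ℕ) (hn : 1 ≤ n) => distInt_pos_of_mem_Omega hφ hθ hn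
  obtain ⟨c, hc, hθc⟩ := exists_one_le_const_of_mem_Omega hφ hθ
  rcases iInter_tailUnion_ae_empty_or_univ hpos hψ with hnull | hfull
  · exfalso
    have hlim := tendsto_measure_iInter_atTop (μ := (volume : Measure UnitAddCircle))
      (fun m => (isOpen_tailUnion θ ψ m).measurableSet.nullMeasurableSet)
      (antitone_tailUnion θ ψ) ⟨0, measure_ne_top _ _⟩
    rw [measure_congr hnull, measure_empty] at hlim
    obtain ⟨m, hmU, hm⟩ := ((hlim.eventually_lt_const (u := ENNReal.ofReal (1 / 8))
      (by simp)).and (eventually_ge_atTop 1)).exists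
    have hU : volume.real (tailUnion θ ψ m) < 1 / 8 := by
      rw [measureReal_def]
      exact (ENNReal.lt_ofReal_iff_toReal_lt (measure_ne_top _ _)).1 hmU
    have httop := htmono.tendsto_atTop
    -- `6 * c` is needed for the rational approximation. With `δ ≥ 9`, `t` grows at least ninefold,
    -- which absorbs the new boundary points: `4|F'| ≤ t + 8t`.
    obtain ⟨i₀, hi₀⟩ := eventually_atTop.1 (((hδtop.comp httop).eventually_ge_atTop
      (max (6 * c) 9)).and (httop.eventually_ge_atTop (2 * m)))
    have key : ∀ k : ℕ, ∃ (V : Set UnitAddCircle) (F : Finset UnitAddCircle), IsOpen V ∧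
        V ⊆ tailUnion θ ψ m ∧ frontier V ⊆ F ∧ 4 * F.card ≤ t (i₀ + k) ∧
        ∑ j ∈ Finset.range k, (t (i₀ + j) : ℝ) * ψ ⌊scale φ δ (t (i₀ + j))⌋₊ ≤ volume.real V := by
      intro k
      induction k with
      | zero => exact ⟨∅, ∅, isOpen_empty, by simp, by simp, by simp, by simp⟩
      | succ k ih =>
        obtain ⟨V, F, hV, hVU, hF, hFc, hsum⟩ := ih
        obtain ⟨hδk, hmk⟩ := hi₀ (i₀ + k) (by omega)
        simp only [Function.comp_apply, sup_le_iff] at hδk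
        obtain ⟨W, F', hW, hWU, hF', hFc', hmeas⟩ :=
          exists_enlargement_in_tailUnion hφ hc hθc hψ hm hU hmk hδk.1 hV hVU hF hFc
        refine ⟨W, F', hW, hWU, hF', ?_, ?_⟩
        · have h1 := hφ.le_scale (φ := φ) (ht1 (i₀ + k)) (hδ1 _ (ht1 _))
          have h2 := h1.trans (hscale (i₀ + k))
          have h3 : ((9 * t (i₀ + k) : ℕ) : ℝ) ≤ t (i₀ + k + 1) := by
            push_cast
            have : (0 : ℝ) ≤ t (i₀ + k) := Nat.cast_nonneg _
            nlinarith
          have h4 : 9 * t (i₀ + k) ≤ t (i₀ + (k + 1)) := by exact_mod_cast h3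
          omega
        · rw [Finset.sum_range_succ]
          linarith
    set f := fun i => (t i : ℝ) * ψ ⌊scale φ δ (t i)⌋₊
    obtain ⟨N, hN, hNi⟩ := ((hdiv.eventually_ge_atTop
      (∑ i ∈ Finset.range i₀, f i + 1)).and (eventually_ge_atTop i₀)).exists
    obtain ⟨k, rfl⟩ := Nat.exists_eq_add_of_le hNi
    obtain ⟨V, F, -, hVU, -, -, hsum⟩ := key k
    have h1 : volume.real V ≤ volume.real (tailUnion θ ψ m) := measureReal_mono hVU
    rw [Finset.sum_range_add] at hN
    linarith
  · have hae : ∀ᵐ x : UnitAddCircle, x ∈ ⋂ m, tailUnion θ ψ m :=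
      eventuallyEq_univ.1 hfull
    filter_upwards [ae_coe_of_ae hae] with s hs
    rw [Set.infinite_iff_exists_gt]
    intro a
    obtain ⟨n, hn, hns⟩ := mem_tailUnion.1 (Set.mem_iInter.1 hs (a + 1))
    refine ⟨n, ⟨by omega, ?_⟩, by omega⟩
    rwa [distInt_eq_norm, AddCircle.coe_sub]

/-! ### Violating denominators and the inclusion `Xi ⊆ Omega` -/

/-- With constant at least `1/ε`, where ε bounds `‖nθ‖` from below for `1 ≤ n < N`, no such `n` can
be a violator. If some `qθ` is an integer, large multiples of `q` serve. -/
lemma exists_large_of_notMem_Omega {φ : ℝ → ℝ} (hφ : IsAdmissible φ) {θ : ℝ} (hθ : θ ∉ Omega φ)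
    {c : ℝ} (hc : 1 ≤ c) (N : ℕ) :
    ∃ n : ℕ, N ≤ n ∧ 1 ≤ n ∧ distInt (n * θ) < n * φ (c * n) := by
  by_cases hpos : ∀ n : ℕ, 1 ≤ n → 0 < distInt (n * θ)
  · obtain ⟨ε, hε, hεN⟩ := exists_pos_le_distInt hpos N
    have hno : ∃ n : ℕ, 1 ≤ n ∧ distInt (n * θ) < n * φ (max c (1 / ε) * n) := by
      by_contra! h
      exact hθ ⟨max c (1 / ε), by positivity, h⟩
    obtain ⟨n, hn, hnθ⟩ := hno
    have hn1 : (1 : ℝ) ≤ n := by exact_mod_cast hn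
    refine ⟨n, ?_, hn, hnθ.trans_le ?_⟩
    · by_contra! hlt
      have h1 := hεN n hn hlt
      have h2 := hφ.mul_phi_le (hc.trans (le_max_left c (1 / ε))) hn
      have h3 : 1 / max c (1 / ε) ≤ ε := by
        rw [div_le_comm₀ (by positivity) hε]
        exact le_max_right _ _
      linarith
    · exact hφ.mul_phi_anti (by linarith) (le_max_left _ _) (by linarith)
        (one_le_mul_of_one_le_of_one_le hc hn1)
  · push Not at hpos
    obtain ⟨q, hq, hq0⟩ := hpos
    have hn : 1 ≤ (N + 1) * q := Nat.mul_pos (by omega) hq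
    have hn1 : (1 : ℝ) ≤ ((N + 1) * q : ℕ) := by exact_mod_cast hn
    refine ⟨(N + 1) * q, by nlinarith, hn, ?_⟩
    have h1 := distInt_natCast_mul_le (N + 1) (q * θ)
    rw [← mul_assoc, ← Nat.cast_mul] at h1
    have h2 := hφ.phi_pos (one_le_mul_of_one_le_of_one_le hc hn1)
    have h3 : ((N + 1 : ℕ) : ℝ) * distInt (q * θ) ≤ 0 :=
      mul_nonpos_of_nonneg_of_nonpos (Nat.cast_nonneg _) hq0
    exact (h1.trans h3).trans_lt (by positivity)

/-- If `n θ` is very close to an integer, then the first multiples of `θ` cluster around the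
first `n` of them. -/
lemma volume_near_multiples_le {θ : ℝ} {n L : ℕ} (hn : 1 ≤ n) {ε : ℝ}
    (h : L * distInt (n * θ) ≤ ε) :
    volume {x : UnitAddCircle | ∃ k ≤ L, ‖((k * θ : ℝ) : UnitAddCircle) - x‖ < ε / n} ≤
      ENNReal.ofReal (4 * ε) := by
  have hn0 : (0 : ℝ) < n := by exact_mod_cast hn
  have hsub : {x : UnitAddCircle | ∃ k ≤ L, ‖((k * θ : ℝ) : UnitAddCircle) - x‖ < ε / n} ⊆
      ⋃ r ∈ Finset.range n, closedBall ((r * θ : ℝ) : UnitAddCircle) (2 * (ε / n)) := by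
    rintro x ⟨k, hkL, hk⟩
    refine Set.mem_iUnion₂.2 ⟨k % n, Finset.mem_range.2 (Nat.mod_lt _ hn), ?_⟩
    rw [mem_closedBall', dist_eq_norm]
    -- Replacing `k` by `k % n` moves the point by at most `(k/n)‖nθ‖ ≤ ε/n`, so `n` balls of radius
    -- `2ε/n` suffice.
    have e : (((k % n : ℕ) * θ : ℝ) : UnitAddCircle) - x =
        (((k * θ : ℝ) : UnitAddCircle) - x) - (((k / n : ℕ) * (n * θ) : ℝ) : UnitAddCircle) := by
      have h1 : (k : ℝ) = (k % n : ℕ) + n * (k / n : ℕ) := by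
        exact_mod_cast (Nat.mod_add_div k n).symm
      have h2 : (k : ℝ) * θ = (k % n : ℕ) * θ + (k / n : ℕ) * (n * θ) := by
        linear_combination θ * h1
      rw [h2, AddCircle.coe_add]
      abel
    rw [e]
    refine (norm_sub_le _ _).trans ?_
    have h3 : ‖(((k / n : ℕ) * (n * θ) : ℝ) : UnitAddCircle)‖ ≤ ε / n := by
      rw [← distInt_eq_norm]
      refine (distInt_natCast_mul_le _ _).trans ?_
      rw [le_div_iff₀ hn0]
      refine le_trans ?_ h
      have h4 : (((k / n * n : ℕ)) : ℝ) ≤ L := by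
        exact_mod_cast (Nat.div_mul_le_self k n).trans hkL
      calc ((k / n : ℕ) : ℝ) * distInt (n * θ) * n = ((k / n * n : ℕ) : ℝ) * distInt (n * θ) := by
            push_cast; ring
        _ ≤ _ := by gcongr; exact distInt_nonneg _
    linarith
  calc _ ≤ volume (⋃ r ∈ Finset.range n,
        closedBall ((r * θ : ℝ) : UnitAddCircle) (2 * (ε / n))) := measure_mono hsub
    _ ≤ ∑ r ∈ Finset.range n, volume (closedBall ((r * θ : ℝ) : UnitAddCircle) (2 * (ε / n))) :=
      measure_biUnion_finset_le _ _
    _ ≤ ∑ r ∈ Finset.range n, ENNReal.ofReal (2 * (2 * (ε / n))) := by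
      refine Finset.sum_le_sum fun r _ => ?_
      rw [AddCircle.volume_closedBall]
      exact ENNReal.ofReal_le_ofReal (min_le_right _ _)
    _ = ENNReal.ofReal (4 * ε) := by
      rw [Finset.sum_const, Finset.card_range, nsmul_eq_mul, ← ENNReal.ofReal_natCast,
        ← ENNReal.ofReal_mul hn0.le]
      congr 1
      field_simp
      ring

/-- A sequence growing fast enough that each stage absorbs the previous ones, all of whose members
violate the bound of `Omega` with ever larger constants. -/
lemma exists_violating_seq {φ : ℝ → ℝ} (hφ : IsAdmissible φ) {θ : ℝ} (hθ : θ ∉ Omega φ) :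
    ∃ n : ℕ → ℕ, (∀ i, 1 ≤ n i) ∧ (∀ i, distInt (n i * θ) < n i * φ (4 ^ i * n i)) ∧
      ∀ i, 1 / ((2 ^ i * n i) * φ (4 ^ i * n i)) + 1 ≤ 2 ^ (i + 1) * (n (i + 1) : ℝ) := by
  choose f hfN hf1 hfθ using fun i N : ℕ =>
    exists_large_of_notMem_Omega hφ hθ (one_le_pow₀ (by norm_num : (1 : ℝ) ≤ 4) : 1 ≤ (4 : ℝ) ^ i) N
  obtain ⟨n, h0, hs⟩ : ∃ n : ℕ → ℕ, n 0 = f 0 0 ∧ ∀ i, n (i + 1) =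
      f (i + 1) (⌈1 / ((2 ^ i * (n i : ℝ)) * φ (4 ^ i * (n i : ℝ)))⌉₊ + 1) := by
    generalize hg : (fun i k : ℕ => ⌈1 / ((2 ^ i * (k : ℝ)) * φ (4 ^ i * (k : ℝ)))⌉₊ + 1) = g
    refine ⟨fun i => Nat.rec (f 0 0) (fun i k => f (i + 1) (g i k)) i, rfl, fun i => ?_⟩
    rw [← hg]
  have hn : ∀ i, ∃ N, n i = f i N := by
    intro i
    cases i with
    | zero => exact ⟨0, h0⟩
    | succ i => exact ⟨_, hs i⟩
  refine ⟨n, fun i => ?_, fun i => ?_, fun i => ?_⟩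
  · obtain ⟨N, hN⟩ := hn i
    rw [hN]; exact hf1 i N
  · obtain ⟨N, hN⟩ := hn i
    rw [hN]; exact hfθ i N
  · have h1 := hfN (i + 1) (⌈1 / ((2 ^ i * (n i : ℝ)) * φ (4 ^ i * (n i : ℝ)))⌉₊ + 1)
    rw [← hs i] at h1
    have h2 : ((⌈1 / ((2 ^ i * (n i : ℝ)) * φ (4 ^ i * n i))⌉₊ : ℝ)) + 1 ≤ n (i + 1) := by
      exact_mod_cast h1
    have h3 := Nat.le_ceil (1 / ((2 ^ i * (n i : ℝ)) * φ (4 ^ i * n i)))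
    have h4 : (1 : ℝ) ≤ 2 ^ (i + 1) := one_le_pow₀ (by norm_num)
    have h5 : (0 : ℝ) ≤ n (i + 1) := Nat.cast_nonneg _
    nlinarith

lemma findGreatest_strictMono_apply {t : ℕ → ℕ} (ht : StrictMono t) (i : ℕ) :
    Nat.findGreatest (fun j => t j ≤ t i) (t i) = i := by
  rw [Nat.findGreatest_eq_iff]
  refine ⟨ht.le_apply, fun _ => le_rfl, fun j hj _ => not_le.2 (ht hj)⟩

/-- A non-decreasing function that tends to infinity and takes the value `2 ^ i` at `t i`. -/
lemma exists_delta {t : ℕ → ℕ} (ht : StrictMono t) :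
    ∃ δ : ℕ → ℝ, Monotone δ ∧ (∀ n, 1 ≤ δ n) ∧ Tendsto δ atTop atTop ∧ ∀ i, δ (t i) = 2 ^ i := by
  -- Below `t 0` the search returns 0 and the value is 1; searching up to `n` suffices because `j ≤
  -- t j`.
  refine ⟨fun n => 2 ^ Nat.findGreatest (fun j => t j ≤ n) n, fun a b hab => ?_, fun n => ?_, ?_,
    fun i => ?_⟩
  · exact pow_le_pow_right₀ (by norm_num)
      (Nat.findGreatest_mono (fun j hj => le_trans hj hab) hab)
  · exact one_le_pow₀ (by norm_num)
  · refine (tendsto_pow_atTop_atTop_of_one_lt (by norm_num)).comp (tendsto_atTop.2 fun i => ?_)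
    filter_upwards [eventually_ge_atTop (t i)] with n hn
    exact Nat.le_findGreatest (ht.le_apply.trans hn) hn
  · simp only [findGreatest_strictMono_apply ht]

/-- A step sequence equal to `1 / t i` on the `i`-th block cut out by the `L i`. -/
lemma exists_step_seq {t L : ℕ → ℕ} (ht : StrictMono t) (ht1 : ∀ i, 1 ≤ t i) (hL : StrictMono L) :
    ∃ ψ : ℕ → ℝ, IsApproxSeq ψ ∧ (∀ i, ψ (L i) = 1 / t i) ∧
      ∀ i n, L i < n → ∃ j, i ≤ j ∧ n ≤ L j ∧ ψ n = 1 / t j := by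
  have hex : ∀ n, ∃ i, n ≤ L i := fun n => ⟨n, hL.le_apply⟩
  refine ⟨fun n => 1 / (t (Nat.find (hex n)) : ℝ), ⟨fun n _ => ?_, fun a _ b _ hab => ?_⟩,
    fun i => ?_, fun i n hn => ⟨Nat.find (hex n), ?_, Nat.find_spec (hex n), rfl⟩⟩
  · have : (0 : ℝ) < t (Nat.find (hex n)) := by exact_mod_cast ht1 _
    positivity
  · have h0 : (0 : ℝ) < t (Nat.find (hex a)) := by exact_mod_cast ht1 _
    refine one_div_le_one_div_of_le h0 ?_
    exact_mod_cast ht.monotone (Nat.find_min' (hex a) (hab.trans (Nat.find_spec (hex b))))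
  · have : Nat.find (hex (L i)) = i := by
      rw [Nat.find_eq_iff]
      exact ⟨le_rfl, fun j hj => not_le.2 (hL hj)⟩
    simp only [this]
  · by_contra! hlt
    have := (Nat.find_spec (hex n)).trans (hL.monotone hlt.le)
    omega

theorem Xi_subset_Omega {φ : ℝ → ℝ} (hφ : IsAdmissible φ) : Xi φ ⊆ Omega φ := by
  intro θ hθΞ
  by_contra hθ
  obtain ⟨n, hn1, hnθ, hngrow⟩ := exists_violating_seq hφ hθ
  have hn0 : ∀ i, (1 : ℝ) ≤ n i := fun i => by exact_mod_cast hn1 i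
  -- With `δ(t i) = 2^i`, φ is evaluated at `4^i n i`. The extra factor `2^i` makes the radius `1/t
  -- i` equal to `2^(-i)/n i`: each term `t i ψ(L i)` is 1, while the covered sets `E i` have
  -- measure at most `4·2^(-i)`.
  set t : ℕ → ℕ := fun i => 2 ^ i * n i with ht
  have ht1 : ∀ i, 1 ≤ t i := fun i => Nat.mul_pos (by positivity) (hn1 i)
  have harg : ∀ i, (t i : ℝ) * 2 ^ i = 4 ^ i * n i := by
    intro i
    simp only [ht, Nat.cast_mul, Nat.cast_pow, Nat.cast_ofNat]
    rw [show (4 : ℝ) = 2 * 2 by norm_num, mul_pow]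
    ring
  have hx : ∀ i, 1 ≤ (4 : ℝ) ^ i * n i := fun i =>
    one_le_mul_of_one_le_of_one_le (one_le_pow₀ (by norm_num)) (hn0 i)
  set S : ℕ → ℝ := fun i => 1 / ((2 ^ i * n i) * φ (4 ^ i * n i)) with hS
  have hS0 : ∀ i, 0 < S i := fun i => by
    have := hφ.phi_pos (hx i)
    have := hn0 i
    simp only [hS]
    positivity
  have htS : ∀ i, (t i : ℝ) ≤ S i := by
    intro i
    have h := hφ.le_scale (δ := fun _ => (2 : ℝ) ^ i) (ht1 i) (one_le_pow₀ (by norm_num))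
    simp only [scale, harg] at h
    have h1 : (t i : ℝ) = 2 ^ i * n i := by simp [ht]
    rw [h1] at h
    refine le_trans ?_ h
    rw [h1, show (4 : ℝ) = 2 * 2 by norm_num, mul_pow, mul_assoc]
    exact le_mul_of_one_le_left (by positivity) (one_le_pow₀ (by norm_num))
  -- The added 1 is what makes `t` and the floors `L` strictly increasing.
  have hSt : ∀ i, S i + 1 ≤ t (i + 1) := fun i => by
    simpa only [ht, Nat.cast_mul, Nat.cast_pow, Nat.cast_ofNat] using hngrow i
  have htmono : StrictMono t := strictMono_nat_of_lt_succ fun i => by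
    have : (t i : ℝ) < t (i + 1) := by linarith [htS i, hSt i]
    exact_mod_cast this
  set L : ℕ → ℕ := fun i => ⌊S i⌋₊ with hLdef
  have hL : StrictMono L := strictMono_nat_of_lt_succ fun i => by
    have h : ⌊S i⌋₊ + 1 ≤ ⌊S (i + 1)⌋₊ := by
      refine Nat.le_floor ?_
      push_cast
      linarith [Nat.floor_le (hS0 i).le, hSt i, htS (i + 1)]
    exact h
  obtain ⟨δ, hδmono, hδ1, hδtop, hδt⟩ := exists_delta htmono
  obtain ⟨ψ, hψ, hψL, hψblock⟩ := exists_step_seq htmono ht1 hL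
  have hscale : ∀ i, scale φ δ (t i) = S i := by
    intro i
    simp only [scale, hδt, harg, hS]
    simp [ht]
  have hdiv : DivergenceCondition φ ψ := by
    refine ⟨t, δ, htmono, ht1, hδmono.monotoneOn _, fun n _ => hδ1 n, hδtop, fun i => ?_, ?_⟩
    · rw [hscale]; linarith [hSt i]
    · have h1 : ∀ i, (t i : ℝ) * ψ ⌊scale φ δ (t i)⌋₊ = 1 := by
        intro i
        have : (0 : ℝ) < t i := by exact_mod_cast ht1 i
        rw [hscale]
        change (t i : ℝ) * ψ (L i) = 1
        rw [hψL]
        field_simp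
      simp only [h1, Finset.sum_const, Finset.card_range, nsmul_eq_mul, mul_one]
      exact tendsto_natCast_atTop_atTop
  set E : ℕ → Set UnitAddCircle := fun i =>
    {x | ∃ k ≤ L i, ‖((k * θ : ℝ) : UnitAddCircle) - x‖ < (1 / 2) ^ i / n i}
  have hE : ∀ i, volume (E i) ≤ ENNReal.ofReal (4 * (1 / 2) ^ i) := by
    intro i
    refine volume_near_multiples_le (hn1 i) ?_
    have hφ0 := hφ.phi_pos (hx i)
    have hni := hn0 i
    calc (L i : ℝ) * distInt (n i * θ) ≤ S i * (n i * φ (4 ^ i * n i)) := by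
          gcongr
          · exact distInt_nonneg _
          · exact Nat.floor_le (hS0 i).le
          · exact (hnθ i).le
      _ = (1 / 2) ^ i := by
          simp only [hS]
          generalize φ (4 ^ i * n i) = y at hφ0
          rw [one_div_pow]
          field_simp
  have hsum : ∑' i, volume (E i) ≠ ⊤ := by
    refine ne_top_of_le_ne_top ?_ (ENNReal.tsum_le_tsum hE)
    exact (summable_geometric_two.mul_left 4).tsum_ofReal_ne_top
  have hfin := ae_coe_of_ae (ae_eventually_notMem hsum)
  obtain ⟨s, hinf, hev⟩ := ((hθΞ ψ hψ hdiv).and hfin).exists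
  obtain ⟨I, hI⟩ := eventually_atTop.1 hev
  refine hinf ((Set.finite_Iic (L I)).subset fun k hk => ?_)
  by_contra hlt
  obtain ⟨j, hIj, hkj, hψk⟩ := hψblock I k (not_le.1 hlt)
  refine hI j hIj ⟨k, hkj, ?_⟩
  have h := hk.2
  rw [distInt_eq_norm, AddCircle.coe_sub, hψk] at h
  refine h.trans_eq ?_
  simp only [ht, Nat.cast_mul, Nat.cast_pow, Nat.cast_ofNat, one_div_pow]
  rw [div_div]

end Kurzweil

theorem mainTheorem3 (φ : ℝ → ℝ) (hφ : Kurzweil.IsAdmissible φ) :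
    Kurzweil.Omega φ = Kurzweil.Xi φ :=
  Set.Subset.antisymm (Kurzweil.Omega_subset_Xi hφ) (Kurzweil.Xi_subset_Omega hφ)
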